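/- For an integer $n\ge 1$ let $K_n\subset S^3$ be the knot obtained as the closure of the $6$-braid \[ \beta_n=(\sigma_3\sigma_2\sigma_4\sigma_1\sigma_3\sigma_5\sigma_2\sigma_4\sigma_3)^{2n+1}\,\sigma_3\sigma_2\sigma_1\sigma_1\sigma_2\sigma_3\sigma_2\sigma_1\sigma_2\sigma_2 , \] where $\sigma_1,\dots,\sigma_5$ are the standard generators of the $6$-strand braid group. Let $\Delta_{K_n}(t)$ be the Alexander polynomial of $K_n$, normalized (it is defined up to units $\pm t^k$) to be a polynomial in $t$ with constant term $1$. Then there is exactly one set $\mathcal{S}\subset\mathbb{Z}_{\ge 0}$, called the formal semigroup of $K_n$, with \[ \frac{\Delta_{K_n}(t)}{1-t}=\sum_{s\in\mathcal{S}}t^s\quad\text{in }\mathbb{Z}[[t]], \] and it is the semigroup \[ \mathcal{S}=\langle 6,\,6n+4,\,6n+8,\,12n+11,\,12n+15\rangle , \] where $\langle p_1,\dots,p_k\rangle=\{a_1p_1+\dots+a_kp_k\mid a_i\in\mathbb{Z}_{\ge 0}\}$. This semigroup has rank $5$, that is, the minimal cardinality of a set that generates it (in this sense) is $5$. -/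

import Mathlib

open scoped LaurentPolynomial

noncomputable section

namespace ClosedBraid

/-- Words in the standard generators of the braid group on `m + 1` strands. The letter `(i, true)`
is the generator `σ` crossing the strands in positions `i` and `i + 1`, and `(i, false)` is its
inverse (positions are counted from `0`). Such a word is a diagram of a braid, and joining its
bottom to its top gives an oriented link diagram, the closure of the word. -/
abbrev BraidWord (m : ℕ) := List (Fin m × Bool)

/-- The segments of the closed braid diagram of `w`: the segment `(k, j)` is the piece of strand in
position `j` directly above the `k`-th letter of `w`; for `k = w.length` it is the piece below the
last letter. -/
abbrev Segment {m : ℕ} (w : BraidWord m) := Fin (w.length + 1) × Fin (m + 1)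

/-- A letter sends the Alexander labels `x` of the segments directly above it to labels of the
segments directly below it; `below a j` is the label of the segment in position `j`, as a vector
of coefficients in `x`. A strand that meets no crossing, or passes over, keeps its label. At a
crossing where the over-strand has label `a`, an under-strand with label `b` goes on with the label
`c = (1 - t) a + t b` if the crossing is positive and `c = (1 - t⁻¹) a + t⁻¹ b` if it is negative:
this is the Fox derivative, with all meridians sent to `t`, of the Wirtinger relation
`c = a b a⁻¹`, respectively `c = a⁻¹ b a`. For `none` there is no crossing at all. -/
def below {m : ℕ} : Option (Fin m × Bool) → Fin (m + 1) → Fin (m + 1) → ℤ[T;T⁻¹]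
  | none, j => Pi.single j 1
  | some (i, true), j =>
      if j = i.succ then Pi.single i.castSucc 1
      else if j = i.castSucc then
        Pi.single i.castSucc (1 - LaurentPolynomial.T 1)
          + Pi.single i.succ (LaurentPolynomial.T 1)
      else Pi.single j 1
  | some (i, false), j =>
      if j = i.castSucc then Pi.single i.succ 1
      else if j = i.succ then
        Pi.single i.succ (1 - LaurentPolynomial.T (-1))
          + Pi.single i.castSucc (LaurentPolynomial.T (-1))
      else Pi.single j 1

/-- The Alexander matrix of the closure of `w`: the generators (columns) are the segments, and the
relation (row) `(k, j)` says that the segment in position `j` on the next level has the label that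
the `k`-th letter gives it. After the last level comes level `0` (`finRotate` is cyclic), and for
`k = w.length` there is no letter, so that these last rows are the relations that close the
braid. -/
def alexanderMatrix {m : ℕ} (w : BraidWord m) : Matrix (Segment w) (Segment w) ℤ[T;T⁻¹] :=
  fun r c =>
    (if c = (finRotate (w.length + 1) r.1, r.2) then 1 else 0)
      - (if c.1 = r.1 then below w[(r.1 : ℕ)]? r.2 c.2 else 0)

/-- `Δ` is an Alexander polynomial of the closure of `w`: a greatest common divisor in `ℤ[t, t⁻¹]`
of the minors of the Alexander matrix with one row and one column deleted (a generator of the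
smallest principal ideal that contains the first elementary ideal). It is determined up to the units
`± t ^ k`. The entries of the adjugate are these minors, up to sign. -/
def IsAlexanderPolynomial {m : ℕ} (w : BraidWord m) (Δ : ℤ[T;T⁻¹]) : Prop :=
  ∀ f : ℤ[T;T⁻¹], f ∣ Δ ↔ ∀ r c : Segment w, f ∣ (alexanderMatrix w).adjugate c r

open Classical in
/-- `S` is the formal semigroup of the closure of `w`: for the Alexander polynomial `Δ`, normalized
to be an ordinary polynomial in `t` with constant term `1`, one has
`Δ / (1 - t) = ∑_{s ∈ S} t ^ s` in `ℤ[[t]]`, written here without the division. -/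
def IsFormalSemigroup {m : ℕ} (w : BraidWord m) (S : Set ℕ) : Prop :=
  ∃ Δ : Polynomial ℤ, IsAlexanderPolynomial w Δ.toLaurent ∧ Δ.coeff 0 = 1 ∧
    (Δ : PowerSeries ℤ) = (1 - PowerSeries.X) * PowerSeries.mk fun s => if s ∈ S then 1 else 0

/-- The `6`-braid
`(σ₃ σ₂ σ₄ σ₁ σ₃ σ₅ σ₂ σ₄ σ₃) ^ (2n+1) σ₃ σ₂ σ₁ σ₁ σ₂ σ₃ σ₂ σ₁ σ₂ σ₂`
(here the generators are numbered from `0`), whose closure is the knot `K_n`. -/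
def beta (n : ℕ) : BraidWord 5 :=
  (List.replicate (2 * n + 1) ([2, 1, 3, 0, 2, 4, 1, 3, 2] : List (Fin 5))).flatten.map
      (fun i => (i, true))
    ++ ([2, 1, 0, 0, 1, 2, 1, 0, 1, 1] : List (Fin 5)).map (fun i => (i, true))

/-- A semigroup of nonnegative integers (containing `0`) has rank `r` if `r` is the minimal
cardinality of a generating set. -/
def HasRank (A : AddSubmonoid ℕ) (r : ℕ) : Prop :=
  IsLeast {k : ℕ | ∃ G : Finset ℕ, AddSubmonoid.closure (G : Set ℕ) = A ∧ G.card = k} r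

end ClosedBraid

end

/-!
The Alexander matrix of a closed braid has row sums zero, and the vector with entry `t ^ j` on every
segment of position `j` is in its left kernel. Hence its cofactors all agree up to units
(`associated_adjugate_alexanderMatrix`), and one of them is the Alexander polynomial. Eliminating
the labels level by level turns this cofactor into a cofactor of `1 - B`, where `B` is the unreduced
Burau matrix of the braid (`isAlexanderPolynomial_iff`).

For `K_n` the Burau matrix is `B = Q * H ^ (2 * n + 1)`, where `H` belongs to a crossing of two
ribbons of three parallel strands and `Q` to the ten remaining letters. The powers of `H` are
explicit: it fixes the constant vectors, has `(t³, t³, t³, -1, -1, -1)` as eigenvector for `-t³`,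
and its square is `t³` on a complement of dimension four (`burau_ribbonCrossing_pow_mulVec`). In a basis adapted to this decomposition and to
the fact that `Q` acts on four positions only, the cofactor reduces to a `3 × 3` determinant, with
the result that `(1 + t³) (1 + t + t²)` times the Alexander polynomial is `∑ t ^ a`, where `a` runs
over `0, 6n+4, 6n+8, 12n+11, 12n+15, 18n+19` (`mul_adjugate_one_sub_burau_beta`).

These numbers are the least elements of the semigroup in the residue classes modulo `6`, so that
`(1 - t⁶) ∑_{s ∈ S} t ^ s` is the same polynomial (`one_sub_X_pow_mul_mk`), and
`1 - t⁶ = (1 - t) (1 + t³) (1 + t + t²)`. The rank is `5` because none of the five generators is a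
sum of two nonzero elements of the semigroup, so that each belongs to every generating set.
-/

namespace ClosedBraid

open Matrix


/-! ### Cofactors of a matrix with a known kernel -/

/-- If the rows of `A` sum to zero, its cofactors along a row all agree: their difference is the
determinant of a matrix whose rows still sum to zero. -/
lemma adjugate_eq_of_mulVec_one {ι R : Type*} [Fintype ι] [DecidableEq ι] [CommRing R] [IsDomain R]
    {A : Matrix ι ι R} (hA : A *ᵥ 1 = 0) (c c' r : ι) : A.adjugate c r = A.adjugate c' r := by
  have : Nonempty ι := ⟨r⟩
  have h0 : (A.updateRow r (Pi.single c 1 - Pi.single c' 1)).det = 0 := by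
    refine exists_mulVec_eq_zero_iff.1 ⟨1, one_ne_zero, ?_⟩
    ext i
    rcases eq_or_ne i r with rfl | hi
    · simp [mulVec, dotProduct_one]
    · simpa [mulVec, hi] using congrFun hA i
  rw [adjugate_apply, adjugate_apply, ← zero_add (det (A.updateRow r (Pi.single c' 1))), ← h0,
    ← det_updateRow_add, sub_add_cancel]

/-- If `v` is in the left kernel of `A`, the cofactors of `A` along a column are proportional
to `v`. -/
lemma mul_adjugate_eq_of_vecMul {ι R : Type*} [Fintype ι] [DecidableEq ι] [CommRing R] [IsDomain R]
    {A : Matrix ι ι R} {v : ι → R} (hv : v ≠ 0) (hA : v ᵥ* A = 0) (c r r' : ι) :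
    v r' * A.adjugate c r = v r * A.adjugate c r' := by
  have h0 : (A.updateCol c (v r' • Pi.single r 1 - v r • Pi.single r' 1)).det = 0 := by
    refine exists_vecMul_eq_zero_iff.1 ⟨v, hv, ?_⟩
    ext i
    rcases eq_or_ne i c with rfl | hi
    · simp [vecMul, dotProduct, mul_sub, Pi.single_apply, mul_comm]
    · simpa [vecMul, hi] using congrFun hA i
  have key (s : ι) : A.adjugate c s = (A.updateCol c (Pi.single s 1)).det := by
    rw [← transpose_apply A.adjugate, adjugate_transpose, adjugate_apply, updateRow_transpose,
      det_transpose]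
  rw [key, key, ← det_updateCol_smul, ← det_updateCol_smul,
    ← zero_add (det (A.updateCol c (v r • Pi.single r' 1))), ← h0, ← det_updateCol_add,
    sub_add_cancel]

/-! ### The Burau representation and the Alexander matrix -/

/-- The matrix by which a letter (or no letter) acts on the Alexander labels. -/
noncomputable def letterMatrix {m : ℕ} (o : Option (Fin m × Bool)) :
    Matrix (Fin (m + 1)) (Fin (m + 1)) ℤ[T;T⁻¹] :=
  Matrix.of (below o)

/-- The unreduced Burau matrix of a word: it sends the labels at the top of the braid to those at
the bottom. Letters that come later in the word act later, hence multiply from the left. -/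
noncomputable def burau {m : ℕ} : BraidWord m → Matrix (Fin (m + 1)) (Fin (m + 1)) ℤ[T;T⁻¹]
  | [] => 1
  | a :: w => burau w * letterMatrix (some a)

lemma burau_append {m : ℕ} (w₁ w₂ : BraidWord m) : burau (w₁ ++ w₂) = burau w₂ * burau w₁ := by
  induction w₁ with
  | nil => simp [burau]
  | cons a w ih => simp [burau, ih, Matrix.mul_assoc]

lemma burau_take_succ {m : ℕ} (w : BraidWord m) (k : ℕ) :
    burau (w.take (k + 1)) = letterMatrix w[k]? * burau (w.take k) := by
  rw [List.take_add_one, burau_append]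
  cases w[k]? with
  | none =>
    have : letterMatrix (m := m) none = 1 := by
      ext i j; simp [letterMatrix, below, Matrix.one_apply, Pi.single_apply, eq_comm]
    simp [burau, this]
  | some a => simp [burau]

lemma letterMatrix_mulVec_one {m : ℕ} (o : Option (Fin m × Bool)) :
    letterMatrix o *ᵥ 1 = 1 := by
  ext1 j
  rcases o with _ | ⟨i, _ | _⟩
  · simp [letterMatrix, below, mulVec]
  all_goals
    simp only [letterMatrix, below, mulVec, of_apply]
    split_ifs <;> simp [dotProduct_one, Finset.sum_add_distrib]

/-- The vector `(1, t, t², …)`. -/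
noncomputable def weight (m : ℕ) (j : Fin (m + 1)) : ℤ[T;T⁻¹] := LaurentPolynomial.T (j : ℕ)

lemma weight_vecMul_letterMatrix {m : ℕ} (o : Option (Fin m × Bool)) :
    weight m ᵥ* letterMatrix o = weight m := by
  ext1 c
  rcases o with _ | ⟨i, b⟩
  · simp [letterMatrix, below, vecMul, dotProduct, Pi.single_apply]
  have hi : i.castSucc ≠ i.succ := (Fin.castSucc_lt_succ).ne
  -- only the rows `i` and `i + 1` differ from those of the identity matrix
  have key : ∀ f g : Fin (m + 1) → Fin (m + 1) → ℤ[T;T⁻¹],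
      (∀ j, j ≠ i.castSucc → j ≠ i.succ → f j c = g j c) →
      weight m i.castSucc * f i.castSucc c + weight m i.succ * f i.succ c
        = weight m i.castSucc * g i.castSucc c + weight m i.succ * g i.succ c →
      ∑ j, weight m j * f j c = ∑ j, weight m j * g j c := by
    intro f g h1 h2
    rw [← Finset.sum_erase_add _ _ (Finset.mem_univ i.castSucc),
      ← Finset.sum_erase_add _ (fun j => weight m j * g j c) (Finset.mem_univ i.castSucc),
      ← Finset.sum_erase_add _ _ (Finset.mem_erase.2 ⟨hi.symm, Finset.mem_univ i.succ⟩),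
      ← Finset.sum_erase_add _ (fun j => weight m j * g j c)
        (Finset.mem_erase.2 ⟨hi.symm, Finset.mem_univ i.succ⟩)]
    have : ∀ j ∈ (Finset.univ.erase i.castSucc).erase i.succ,
        weight m j * f j c = weight m j * g j c := by
      intro j hj
      simp only [Finset.mem_erase] at hj
      rw [h1 j hj.2.1 hj.1]
    rw [Finset.sum_congr rfl this]
    linear_combination h2
  have hw : weight m i.succ = weight m i.castSucc * LaurentPolynomial.T 1 := by
    rw [weight, weight, ← LaurentPolynomial.T_add]; simp
  have hT : (LaurentPolynomial.T 1 * LaurentPolynomial.T (-1) : ℤ[T;T⁻¹]) = 1 := by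
    rw [← LaurentPolynomial.T_add]; simp
  have hone : ∑ j, weight m j * (Pi.single j 1 : Fin (m + 1) → ℤ[T;T⁻¹]) c = weight m c := by
    simp [Pi.single_apply]
  rw [← hone]
  refine key (below (some (i, b))) (fun j => Pi.single j 1) ?_ ?_
  · intro j h1 h2
    cases b <;> simp [below, h1, h2]
  · have e1 : below (some (i, true)) i.castSucc = Pi.single i.castSucc (1 - LaurentPolynomial.T 1)
        + Pi.single i.succ (LaurentPolynomial.T 1) := by simp [below, hi]
    have e2 : below (some (i, true)) i.succ = Pi.single i.castSucc 1 := by simp [below]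
    have e3 : below (some (i, false)) i.castSucc = Pi.single i.succ 1 := by simp [below]
    have e4 : below (some (i, false)) i.succ = Pi.single i.succ (1 - LaurentPolynomial.T (-1))
        + Pi.single i.castSucc (LaurentPolynomial.T (-1)) := by simp [below, hi.symm]
    cases b
    · rw [e3, e4, hw]
      simp only [Pi.add_apply, Pi.single_apply]
      split_ifs
      · ring
      · linear_combination - weight m i.castSucc * hT
      · linear_combination weight m i.castSucc * hT
      · ring
    · rw [e1, e2, hw]
      simp only [Pi.add_apply, Pi.single_apply]
      split_ifs <;> ring

lemma alexanderMatrix_mulVec_one {m : ℕ} (w : BraidWord m) : alexanderMatrix w *ᵥ 1 = 0 := by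
  ext1 r
  have h := congrFun (letterMatrix_mulVec_one w[(r.1 : ℕ)]?) r.2
  simp only [mulVec, dotProduct_one, Pi.one_apply, letterMatrix, of_apply] at h
  simp only [mulVec, dotProduct_one, alexanderMatrix, Finset.sum_sub_distrib]
  simp [Fintype.sum_prod_type, h]

lemma weight_vecMul_alexanderMatrix {m : ℕ} (w : BraidWord m) :
    (fun r : Segment w => weight m r.2) ᵥ* alexanderMatrix w = 0 := by
  ext1 c
  have h := congrFun (weight_vecMul_letterMatrix w[(c.1 : ℕ)]?) c.2
  simp only [vecMul, dotProduct, letterMatrix, of_apply] at h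
  simp only [vecMul, dotProduct, alexanderMatrix, mul_sub, Finset.sum_sub_distrib,
    Fintype.sum_prod_type]
  have h1 : ∀ k : Fin (w.length + 1), ∀ j, c = (finRotate (w.length + 1) k, j) ↔
      (k = (finRotate (w.length + 1)).symm c.1 ∧ j = c.2) := by
    intro k j
    rw [Equiv.eq_symm_apply, Prod.ext_iff]
    tauto
  simp only [h1, ite_and, mul_ite, mul_one, mul_zero, Pi.zero_apply]
  simp [h]

/-- The cofactors of the Alexander matrix of `w` are, up to units, all equal. -/
lemma associated_adjugate_alexanderMatrix {m : ℕ} (w : BraidWord m) (c c' r r' : Segment w) :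
    Associated ((alexanderMatrix w).adjugate c r) ((alexanderMatrix w).adjugate c' r') := by
  have hu (j : Fin (m + 1)) : IsUnit (weight m j) := LaurentPolynomial.isUnit_T _
  have hv : (fun r : Segment w => weight m r.2) ≠ 0 := fun h => (hu r.2).ne_zero (congrFun h r)
  have h := mul_adjugate_eq_of_vecMul hv (weight_vecMul_alexanderMatrix w) c r r'
  rw [← adjugate_eq_of_mulVec_one (alexanderMatrix_mulVec_one w) c c' r']
  exact (associated_unit_mul_left _ _ (hu r'.2)).symm.trans
    (h ▸ associated_unit_mul_left _ _ (hu r.2))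

/-- Matrix of the column operation that expresses all labels through those on level `0`: its
columns of level `0` carry the labels that the top labels of the braid generate. -/
noncomputable def propagation {m : ℕ} (w : BraidWord m) :
    Matrix (Segment w) (Segment w) ℤ[T;T⁻¹] := fun r c =>
  if c.1 = 0 then burau (w.take r.1) r.2 c.2 else if r = c then 1 else 0

lemma det_propagation {m : ℕ} (w : BraidWord m) : (propagation w).det = 1 := by
  rw [twoBlockTriangular_det' _ (fun r => r.1 = 0)]
  · have h1 : (propagation w).toSquareBlockProp (fun r => r.1 = 0) = 1 := by
      ext ⟨⟨k, i⟩, hr⟩ ⟨⟨l, j⟩, hc⟩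
      obtain rfl : k = 0 := hr
      obtain rfl : l = 0 := hc
      simp [toSquareBlockProp, propagation, burau, Matrix.one_apply]
    have h2 : (propagation w).toSquareBlockProp (fun r => ¬ r.1 = 0) = 1 := by
      ext ⟨⟨k, i⟩, hr⟩ ⟨⟨l, j⟩, hc⟩
      have hl : l ≠ 0 := hc
      simp [toSquareBlockProp, propagation, hl, Matrix.one_apply]
    simp [h1, h2]
  · rintro ⟨k, i⟩ hr ⟨l, j⟩ hc
    obtain rfl : k = 0 := hr
    have hl : l ≠ 0 := hc
    simp [propagation, hl, hl.symm]

lemma alexanderMatrix_mul_propagation {m : ℕ} (w : BraidWord m) (r c : Segment w) :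
    (alexanderMatrix w * propagation w) r c =
      if c.1 = 0 then (if r.1 = Fin.last _ then (1 - burau w) r.2 c.2 else 0)
      else alexanderMatrix w r c := by
  obtain ⟨k, i⟩ := r
  obtain ⟨l, j⟩ := c
  by_cases hl : l = 0
  · subst hl
    have h1 : (alexanderMatrix w * propagation w) (k, i) (0, j) =
        burau (w.take (finRotate (w.length + 1) k)) i j - burau (w.take (k + 1)) i j := by
      rw [burau_take_succ, Matrix.mul_apply, Matrix.mul_apply]
      simp only [propagation, alexanderMatrix, if_true, sub_mul, Finset.sum_sub_distrib, ite_mul,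
        one_mul, zero_mul, Finset.sum_ite_eq', Finset.mem_univ, Fintype.sum_prod_type]
      simp [letterMatrix]
    rw [h1]
    rcases Fin.eq_castSucc_or_eq_last k with ⟨k, rfl⟩ | rfl
    · simp [k.castSucc_lt_last.ne]
    · simp [burau, List.take_of_length_le]
  · simp [propagation, hl, Matrix.mul_apply]

/-- With the closing relation of position `0` replaced by `x = 0` for the top label `x` of that
position, eliminating all levels but the top one turns the Alexander matrix into the likewise
modified matrix `1 - B`, where `B` is the Burau matrix. -/
lemma associated_adjugate_one_sub_burau {m : ℕ} (w : BraidWord m) :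
    Associated ((alexanderMatrix w).adjugate (0, 0) (Fin.last _, 0))
      ((1 - burau w).adjugate 0 0) := by
  set Z : Matrix (Segment w) (Segment w) ℤ[T;T⁻¹] :=
    (alexanderMatrix w).updateRow (Fin.last _, 0) (Pi.single (0, 0) 1) * propagation w with hZ
  have hrow : (Pi.single (0, 0) 1 : Segment w → ℤ[T;T⁻¹]) ᵥ* propagation w
      = Pi.single (0, 0) 1 := by
    ext ⟨l, j⟩
    by_cases hl : l = 0
    · subst hl
      simp [propagation, burau, Matrix.one_apply, Pi.single_apply, eq_comm]
    · simp [propagation, hl, Ne.symm hl]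
  rw [updateRow_mul, hrow] at hZ
  have hdet : (alexanderMatrix w).adjugate (0, 0) (Fin.last _, 0) = Z.det := by
    rw [hZ, ← hrow, ← updateRow_mul, det_mul, det_propagation, mul_one, adjugate_apply]
  let σ : Equiv.Perm (Segment w) := (finRotate (w.length + 1)).symm.prodCongr (Equiv.refl _)
  have hσ : Associated Z.det (Z.submatrix σ id).det := by
    rw [det_permute]
    exact (associated_unit_mul_left _ _ ((Equiv.Perm.sign σ).isUnit.map (Int.castRingHom _))).symm
  rw [hdet]
  refine hσ.trans ?_
  have hfirst (i j) : Z.submatrix σ id (0, i) (0, j) =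
      (1 - burau w).updateRow 0 (Pi.single 0 1) i j := by
    have h0 : σ (0, i) = (Fin.last _, i) := by
      simp only [σ, Equiv.prodCongr_apply, Prod.map, Equiv.refl_apply, Prod.mk.injEq, and_true]
      rw [Equiv.symm_apply_eq, finRotate_last]
    simp only [submatrix_apply, h0, id, hZ, updateRow_apply, Prod.mk.injEq, true_and]
    split_ifs <;> simp [alexanderMatrix_mul_propagation, Pi.single_apply]
  have hnext (k : Fin w.length) (i) (c : Segment w) : Z.submatrix σ id (k.succ, i) c =
      if c.1 = 0 then 0 else alexanderMatrix w (k.castSucc, i) c := by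
    have h0 : σ (k.succ, i) = (k.castSucc, i) := by
      simp only [σ, Equiv.prodCongr_apply, Prod.map, Equiv.refl_apply, Prod.mk.injEq, and_true]
      rw [Equiv.symm_apply_eq]
      simp
    simp only [submatrix_apply, h0, id, hZ, updateRow_apply, Prod.mk.injEq,
      k.castSucc_lt_last.ne, false_and, if_false, alexanderMatrix_mul_propagation]
  -- The relations, moved down one level, are block triangular for the order `0, L, L - 1, …, 1`
  -- of the levels.
  let b : Segment w → ℕ := fun r => if r.1 = 0 then 0 else w.length + 1 - r.1
  have hb : (Z.submatrix σ id).BlockTriangular b := by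
    rintro ⟨k, i⟩ ⟨l, j⟩ h
    rcases Fin.eq_zero_or_eq_succ k with rfl | ⟨k, rfl⟩
    · simp [b] at h
    · rw [hnext]
      by_cases hl : l = 0
      · simp [hl]
      · have hlk : k.succ < l := by
          simp only [b, hl, if_false, Fin.succ_ne_zero, Fin.val_succ] at h
          rw [Fin.lt_def, Fin.val_succ]
          omega
        have h1 : l ≠ k.castSucc := ((Fin.castSucc_lt_succ).trans hlk).ne'
        have h2 : l ≠ k.succ := hlk.ne'
        simp [hl, alexanderMatrix, h1, h2]
  rw [hb.det, ← Finset.mul_prod_erase _ _ (a := 0) (Finset.mem_image.2 ⟨(0, 0), by simp, rfl⟩),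
    Finset.prod_eq_one, mul_one]
  · let e : Fin (m + 1) ≃ {r : Segment w // b r = 0} :=
      { toFun := fun i => ⟨(0, i), rfl⟩
        invFun := fun r => r.1.2
        left_inv := fun i => rfl
        right_inv := by
          rintro ⟨⟨k, i⟩, h⟩
          have hk : k = 0 := by
            by_contra hk
            simp only [b, hk, if_false] at h
            omega
          simp [hk] }
    rw [← det_submatrix_equiv_self e, adjugate_apply]
    refine Associated.of_eq (congrArg det ?_)
    exact Matrix.ext fun i j => hfirst i j
  · intro a ha
    have ha0 : a ≠ 0 := (Finset.mem_erase.1 ha).1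
    suffices h1 : (Z.submatrix σ id).toSquareBlock b a = 1 by rw [h1, det_one]
    ext ⟨⟨k, i⟩, hr⟩ ⟨⟨l, j⟩, hc⟩
    rcases Fin.eq_zero_or_eq_succ k with rfl | ⟨k, rfl⟩
    · exact absurd hr.symm ha0
    rcases Fin.eq_zero_or_eq_succ l with rfl | ⟨l, rfl⟩
    · exact absurd hc.symm ha0
    obtain rfl : k = l := by
      simp only [b, Fin.succ_ne_zero, if_false, Fin.val_succ] at hr hc
      ext
      omega
    rw [toSquareBlock_def, of_apply, hnext]
    have h1 : k.succ ≠ k.castSucc := (Fin.castSucc_lt_succ).ne'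
    simp [alexanderMatrix, h1, Matrix.one_apply, eq_comm]

/-- The Alexander polynomial of the closure of `w` is the determinant of the matrix that arises from
`1 - B`, where `B` is the unreduced Burau matrix of `w`, by deleting the first row and column. -/
theorem isAlexanderPolynomial_iff {m : ℕ} (w : BraidWord m) (Δ : ℤ[T;T⁻¹]) :
    IsAlexanderPolynomial w Δ ↔ Associated Δ ((1 - burau w).adjugate 0 0) := by
  have h (r c : Segment w) : Associated ((alexanderMatrix w).adjugate c r)
      ((1 - burau w).adjugate 0 0) :=
    (associated_adjugate_alexanderMatrix w _ _ _ _).trans (associated_adjugate_one_sub_burau w)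
  constructor
  · intro hΔ
    refine associated_of_dvd_dvd ?_ ?_
    · exact ((hΔ Δ).1 dvd_rfl (0, 0) (0, 0)).trans (h _ _).dvd
    · exact (hΔ _).2 fun r c => (h r c).symm.dvd
  · intro hΔ f
    exact ⟨fun hf r c => hf.trans (hΔ.trans (h r c).symm).dvd,
      fun hf => (hf (0, 0) (0, 0)).trans ((h _ _).trans hΔ.symm).dvd⟩


/-! ### The Burau matrix of `K_n` -/

lemma letterMatrix_zero_mulVec (a b c d e f : ℤ[T;T⁻¹]) :
    letterMatrix (some ((0 : Fin 5), true)) *ᵥ ![a, b, c, d, e, f] =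
      ![(1 - LaurentPolynomial.T 1) * a + LaurentPolynomial.T 1 * b, a, c, d, e, f] := by
  ext1 j
  fin_cases j <;> simp [letterMatrix, below, mulVec, dotProduct, Fin.sum_univ_succ]

lemma letterMatrix_one_mulVec (a b c d e f : ℤ[T;T⁻¹]) :
    letterMatrix (some ((1 : Fin 5), true)) *ᵥ ![a, b, c, d, e, f] =
      ![a, (1 - LaurentPolynomial.T 1) * b + LaurentPolynomial.T 1 * c, b, d, e, f] := by
  ext1 j
  fin_cases j <;> simp [letterMatrix, below, mulVec, dotProduct, Fin.sum_univ_succ]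

lemma letterMatrix_two_mulVec (a b c d e f : ℤ[T;T⁻¹]) :
    letterMatrix (some ((2 : Fin 5), true)) *ᵥ ![a, b, c, d, e, f] =
      ![a, b, (1 - LaurentPolynomial.T 1) * c + LaurentPolynomial.T 1 * d, c, e, f] := by
  ext1 j
  fin_cases j <;> simp [letterMatrix, below, mulVec, dotProduct, Fin.sum_univ_succ]

lemma letterMatrix_three_mulVec (a b c d e f : ℤ[T;T⁻¹]) :
    letterMatrix (some ((3 : Fin 5), true)) *ᵥ ![a, b, c, d, e, f] =
      ![a, b, c, (1 - LaurentPolynomial.T 1) * d + LaurentPolynomial.T 1 * e, d, f] := by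
  ext1 j
  fin_cases j <;> simp [letterMatrix, below, mulVec, dotProduct, Fin.sum_univ_succ]

lemma letterMatrix_four_mulVec (a b c d e f : ℤ[T;T⁻¹]) :
    letterMatrix (some ((4 : Fin 5), true)) *ᵥ ![a, b, c, d, e, f] =
      ![a, b, c, d, (1 - LaurentPolynomial.T 1) * e + LaurentPolynomial.T 1 * f, e] := by
  ext1 j
  fin_cases j <;> simp [letterMatrix, below, mulVec, dotProduct, Fin.sum_univ_succ]

/-- The word `σ₃ σ₂ σ₄ σ₁ σ₃ σ₅ σ₂ σ₄ σ₃`, in which the left three strands pass over the right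
three. -/
def ribbonCrossing : BraidWord 5 :=
  ([2, 1, 3, 0, 2, 4, 1, 3, 2] : List (Fin 5)).map fun i => (i, true)

/-- The ten letters that follow the ribbon crossings in the word of `K_n`. -/
def twistWord : BraidWord 5 :=
  ([2, 1, 0, 0, 1, 2, 1, 0, 1, 1] : List (Fin 5)).map fun i => (i, true)

lemma burau_beta (n : ℕ) : burau (beta n) = burau twistWord * burau ribbonCrossing ^ (2 * n + 1) := by
  have h (k : ℕ) (l : List (Fin 5)) :
      burau ((List.replicate k l).flatten.map fun i => (i, true)) =
        burau (l.map fun i => (i, true)) ^ k := by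
    induction k with
    | zero => simp [burau]
    | succ k ih =>
      rw [List.replicate_succ, List.flatten_cons, List.map_append, burau_append, ih, pow_succ]
  rw [beta, burau_append, h]
  rfl

lemma burau_ribbonCrossing_mulVec {t : ℤ[T;T⁻¹]} (ht : t = LaurentPolynomial.T 1)
    (a b c d e f : ℤ[T;T⁻¹]) :
    burau ribbonCrossing *ᵥ ![a, b, c, d, e, f] =
      ![(1 - t) * (a + t * b + t ^ 2 * c) + t ^ 3 * d,
        (1 - t) * (a + t * b + t ^ 2 * c) + t ^ 3 * e,
        (1 - t) * (a + t * b + t ^ 2 * c) + t ^ 3 * f, a, b, c] := by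
  simp only [ribbonCrossing, burau, List.map_cons, List.map_nil, ← mulVec_mulVec,
    letterMatrix_zero_mulVec, letterMatrix_one_mulVec, letterMatrix_two_mulVec,
    letterMatrix_three_mulVec, letterMatrix_four_mulVec, one_mulVec, ← ht]
  ext1 j
  fin_cases j <;> simp <;> ring

lemma burau_twistWord_mulVec {t : ℤ[T;T⁻¹]} (ht : t = LaurentPolynomial.T 1)
    (a b c d e f : ℤ[T;T⁻¹]) :
    burau twistWord *ᵥ ![a, b, c, d, e, f] =
      ![(1 - t) * a + (t - t ^ 2) * b + (t ^ 2 - t ^ 3 + t ^ 4) * c + (t ^ 3 - t ^ 4) * d,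
        (1 - t + t ^ 3) * a + (t - t ^ 2) * b + (t ^ 2 - 2 * t ^ 3 + t ^ 4) * c
          + (t ^ 3 - t ^ 4) * d,
        (1 - t) * a + (t - t ^ 2 + t ^ 3) * b + (t ^ 2 - 2 * t ^ 3 + t ^ 4) * c
          + (t ^ 3 - t ^ 4) * d,
        (1 - t) * a + (t - t ^ 2) * b + (t ^ 2 - t ^ 3) * c + t ^ 3 * d, e, f] := by
  simp only [twistWord, burau, List.map_cons, List.map_nil, ← mulVec_mulVec,
    letterMatrix_zero_mulVec, letterMatrix_one_mulVec, letterMatrix_two_mulVec, one_mulVec, ← ht]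
  ext1 j
  fin_cases j <;> simp <;> ring

/-- The action of an odd power of the ribbon crossing. The square of the crossing is multiplication
by `t³` on the space of all `(a, b, c, d, e, f)` with `a + t b + t² c = 0` and
`d + t e + t² f = 0`, here parametrized by `p, q, r, s`; the crossing itself has
`(t³, t³, t³, -1, -1, -1)`, the coefficient of `z`, as an eigenvector for `-t³`. -/
lemma burau_ribbonCrossing_pow_mulVec {t : ℤ[T;T⁻¹]} (ht : t = LaurentPolynomial.T 1) (n : ℕ)
    (p q r s z : ℤ[T;T⁻¹]) :
    burau ribbonCrossing ^ (2 * n + 1) *ᵥ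
      ![t * p + t ^ 3 * z, t * q - p + t ^ 3 * z, - q + t ^ 3 * z, t * r - z, t * s - r - z,
        - s - z] =
      ![t ^ (3 * n + 3) * (t * r) - t ^ (6 * n + 3) * (t ^ 3 * z),
        t ^ (3 * n + 3) * (t * s - r) - t ^ (6 * n + 3) * (t ^ 3 * z),
        t ^ (3 * n + 3) * (- s) - t ^ (6 * n + 3) * (t ^ 3 * z),
        t ^ (3 * n) * (t * p) + t ^ (6 * n + 3) * z, t ^ (3 * n) * (t * q - p) + t ^ (6 * n + 3) * z,
        t ^ (3 * n) * (- q) + t ^ (6 * n + 3) * z] := by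
  induction n generalizing p q r s z with
  | zero =>
    rw [mul_zero, zero_add, pow_one, burau_ribbonCrossing_mulVec ht]
    ext1 j
    fin_cases j <;> simp <;> ring
  | succ n ih =>
    rw [show 2 * (n + 1) + 1 = 1 + (1 + (2 * n + 1)) by ring, pow_add, pow_add _ 1, pow_one,
      ← mulVec_mulVec, ← mulVec_mulVec, ih, burau_ribbonCrossing_mulVec ht,
      burau_ribbonCrossing_mulVec ht]
    ext1 j
    fin_cases j <;> simp <;> ring

lemma burau_mulVec_one {m : ℕ} (w : BraidWord m) : burau w *ᵥ 1 = 1 := by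
  induction w with
  | nil => simp [burau]
  | cons a w ih => rw [burau, ← mulVec_mulVec, letterMatrix_mulVec_one, ih]

lemma det_eq_of_zero_bottom_left {R : Type*} [CommRing R]
    (r₁ r₂ r₃ r₄ r₅ a₁ a₂ a₃ a₄ a₅ b₁ b₂ b₃ b₄ b₅ c₁ c₂ c₃ c₄ c₅ t : R) :
    det !![1, r₁, r₂, r₃, r₄, r₅; 0, a₁, a₂, a₃, a₄, a₅; 0, b₁, b₂, b₃, b₄, b₅;
      0, c₁, c₂, c₃, c₄, c₅; 0, 0, 0, 0, -1, t; 0, 0, 0, 0, 0, -1] =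
      det !![a₁, a₂, a₃; b₁, b₂, b₃; c₁, c₂, c₃] := by
  rw [← det_submatrix_equiv_self (finSumFinEquiv (m := 4) (n := 2))]
  trans det (fromBlocks !![1, r₁, r₂, r₃; 0, a₁, a₂, a₃; 0, b₁, b₂, b₃; 0, c₁, c₂, c₃]
    !![r₄, r₅; a₄, a₅; b₄, b₅; c₄, c₅] 0 !![-1, t; 0, -1])
  · congr 1
    ext (i | i) (j | j) <;> fin_cases i <;> fin_cases j <;> rfl
  · rw [det_fromBlocks_zero₂₁, det_fin_two, det_succ_column_zero]
    simp [Fin.sum_univ_succ, det_fin_three]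

lemma det_eq_of_zero_top_right {R : Type*} [CommRing R]
    (t u₁ u₂ u₃ v₁ v₂ v₃ w₁ w₂ w₃ : R) :
    det !![1, t, 0, 0, 0, 0; 1, -1, t, 0, 0, 0; 1, 0, -1, 0, 0, 0;
      1, u₁, v₁, w₁, t, 0; 1, u₂, v₂, w₂, -1, t; 1, u₃, v₃, w₃, 0, -1] =
      (1 + t + t ^ 2) * (w₁ + t * w₂ + t ^ 2 * w₃) := by
  rw [← det_submatrix_equiv_self (finSumFinEquiv (m := 3) (n := 3))]
  trans det (fromBlocks !![1, t, 0; 1, -1, t; 1, 0, -1] 0 !![1, u₁, v₁; 1, u₂, v₂; 1, u₃, v₃]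
    !![w₁, t, 0; w₂, -1, t; w₃, 0, -1])
  · congr 1
    ext (i | i) (j | j) <;> fin_cases i <;> fin_cases j <;> rfl
  · rw [det_fromBlocks_zero₁₂, det_fin_three, det_fin_three]
    simp
    ring

/-- The Alexander polynomial of `K_n`, up to units, as a cofactor of `1 - B`. The matrix is
multiplied by a matrix `F` whose columns are simple for powers of the ribbon crossing and are chosen
such that the product vanishes in the first four columns of the last two rows. This is possible
because the letters after the ribbon crossings do not act on the last two positions. -/
lemma mul_adjugate_one_sub_burau_beta (n : ℕ) {t : ℤ[T;T⁻¹]} (ht : t = LaurentPolynomial.T 1) :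
    (1 + t ^ 3) * (1 + t + t ^ 2) * (1 - burau (beta n)).adjugate 0 0 =
      1 + t ^ (6 * n + 4) + t ^ (6 * n + 8) + t ^ (12 * n + 11) + t ^ (12 * n + 15)
        + t ^ (18 * n + 19) := by
  obtain ⟨y, hy⟩ : ∃ y, y = t ^ (3 * n) := ⟨_, rfl⟩
  obtain ⟨h, hh⟩ : ∃ h, h = 1 + t ^ 3 * y ^ 2 := ⟨_, rfl⟩
  have e1 : t ^ (3 * n + 3) = y * t ^ 3 := by rw [hy]; ring
  have e2 : t ^ (6 * n + 3) = y ^ 2 * t ^ 3 := by rw [hy]; ring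
  -- The rows `1, 2, 3` of `1 - burau (beta n)`, in the coordinates of
  -- `burau_ribbonCrossing_pow_mulVec`.
  obtain ⟨ν₁, h₁⟩ : ∃ ν : ℤ[T;T⁻¹] → ℤ[T;T⁻¹] → ℤ[T;T⁻¹] → ℤ[T;T⁻¹] → ℤ[T;T⁻¹] → ℤ[T;T⁻¹],
      ∀ p q r s z, ν p q r s z = t * q - p + t ^ 3 * z -
        ((1 - t + t ^ 3) * (y * t ^ 4 * r - y ^ 2 * t ^ 6 * z)
          + (t - t ^ 2) * (y * t ^ 3 * (t * s - r) - y ^ 2 * t ^ 6 * z)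
          + (t ^ 2 - 2 * t ^ 3 + t ^ 4) * (- y * t ^ 3 * s - y ^ 2 * t ^ 6 * z)
          + (t ^ 3 - t ^ 4) * (y * t * p + y ^ 2 * t ^ 3 * z)) :=
    ⟨fun _ _ _ _ _ => _, fun _ _ _ _ _ => rfl⟩
  obtain ⟨ν₂, h₂⟩ : ∃ ν : ℤ[T;T⁻¹] → ℤ[T;T⁻¹] → ℤ[T;T⁻¹] → ℤ[T;T⁻¹] → ℤ[T;T⁻¹] → ℤ[T;T⁻¹],
      ∀ p q r s z, ν p q r s z = - q + t ^ 3 * z -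
        ((1 - t) * (y * t ^ 4 * r - y ^ 2 * t ^ 6 * z)
          + (t - t ^ 2 + t ^ 3) * (y * t ^ 3 * (t * s - r) - y ^ 2 * t ^ 6 * z)
          + (t ^ 2 - 2 * t ^ 3 + t ^ 4) * (- y * t ^ 3 * s - y ^ 2 * t ^ 6 * z)
          + (t ^ 3 - t ^ 4) * (y * t * p + y ^ 2 * t ^ 3 * z)) :=
    ⟨fun _ _ _ _ _ => _, fun _ _ _ _ _ => rfl⟩
  obtain ⟨ν₃, h₃⟩ : ∃ ν : ℤ[T;T⁻¹] → ℤ[T;T⁻¹] → ℤ[T;T⁻¹] → ℤ[T;T⁻¹] → ℤ[T;T⁻¹] → ℤ[T;T⁻¹],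
      ∀ p q r s z, ν p q r s z = t * r - z -
        ((1 - t) * (y * t ^ 4 * r - y ^ 2 * t ^ 6 * z)
          + (t - t ^ 2) * (y * t ^ 3 * (t * s - r) - y ^ 2 * t ^ 6 * z)
          + (t ^ 2 - t ^ 3) * (- y * t ^ 3 * s - y ^ 2 * t ^ 6 * z)
          + t ^ 3 * (y * t * p + y ^ 2 * t ^ 3 * z)) :=
    ⟨fun _ _ _ _ _ => _, fun _ _ _ _ _ => rfl⟩
  have hN (p q r s z : ℤ[T;T⁻¹]) : ∃ x, (1 - burau (beta n)) *ᵥ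
      ![t * p + t ^ 3 * z, t * q - p + t ^ 3 * z, - q + t ^ 3 * z, t * r - z, t * s - r - z,
        - s - z] = ![x, ν₁ p q r s z, ν₂ p q r s z, ν₃ p q r s z,
          t * s - r - z - (y * (t * q - p) + y ^ 2 * t ^ 3 * z),
          - s - z - (- y * q + y ^ 2 * t ^ 3 * z)] := by
    refine ⟨((1 - burau (beta n)) *ᵥ
      ![t * p + t ^ 3 * z, t * q - p + t ^ 3 * z, - q + t ^ 3 * z, t * r - z, t * s - r - z,
        - s - z]) 0, ?_⟩
    ext1 j
    rw [sub_mulVec, one_mulVec, burau_beta, ← mulVec_mulVec, burau_ribbonCrossing_pow_mulVec ht,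
      burau_twistWord_mulVec ht, e1, e2, ← hy, h₁, h₂, h₃]
    fin_cases j <;> simp <;> ring
  have hN0 : (1 - burau (beta n)) *ᵥ ![1, 1, 1, 1, 1, 1] = 0 := by
    have : (![1, 1, 1, 1, 1, 1] : Fin 6 → ℤ[T;T⁻¹]) = 1 := by ext1 j; fin_cases j <;> rfl
    rw [this, sub_mulVec, one_mulVec, burau_mulVec_one, sub_self]
  obtain ⟨x₁, hx₁⟩ := hN 1 0 y 0 0
  obtain ⟨x₂, hx₂⟩ := hN 0 1 0 y 0
  obtain ⟨x₃, hx₃⟩ := hN 0 0 (- (h * (1 + t))) (- h) 1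
  obtain ⟨x₄, hx₄⟩ := hN 0 0 1 0 0
  obtain ⟨x₅, hx₅⟩ := hN 0 0 0 1 0
  -- The constant vector comes first. The parameters of the next two columns and the value of `h`
  -- make rows `4` and `5` of the product vanish there; adding the multiple `-t³` of the constant
  -- vector to column `3` makes `F` block triangular.
  let F : Matrix (Fin 6) (Fin 6) ℤ[T;T⁻¹] := !![1, t, 0, 0, 0, 0; 1, -1, t, 0, 0, 0;
    1, 0, -1, 0, 0, 0;
    1, t * y, 0, t * (- (h * (1 + t))) - 1 - t ^ 3, t, 0;
    1, - y, t * y, t * (- h) - (- (h * (1 + t))) - 1 - t ^ 3, -1, t;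
    1, 0, -y, h - 1 - t ^ 3, 0, -1]
  have hF : (1 - burau (beta n)).updateRow 0 (Pi.single 0 1) * F = !![1, t, 0, 0, 0, 0;
      0, ν₁ 1 0 y 0 0, ν₁ 0 1 0 y 0, ν₁ 0 0 (- (h * (1 + t))) (- h) 1, ν₁ 0 0 1 0 0, ν₁ 0 0 0 1 0;
      0, ν₂ 1 0 y 0 0, ν₂ 0 1 0 y 0, ν₂ 0 0 (- (h * (1 + t))) (- h) 1, ν₂ 0 0 1 0 0, ν₂ 0 0 0 1 0;
      0, ν₃ 1 0 y 0 0, ν₃ 0 1 0 y 0, ν₃ 0 0 (- (h * (1 + t))) (- h) 1, ν₃ 0 0 1 0 0, ν₃ 0 0 0 1 0;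
      0, 0, 0, 0, -1, t; 0, 0, 0, 0, 0, -1] := by
    have hcol (j : Fin 6) (i : Fin 6) :
        ((1 - burau (beta n)) * F) i j = ((1 - burau (beta n)) *ᵥ (Fᵀ j)) i := rfl
    have g0 : Fᵀ 0 = ![1, 1, 1, 1, 1, 1] := by ext1 j; fin_cases j <;> rfl
    have g1 : Fᵀ 1 = ![t * 1 + t ^ 3 * 0, t * 0 - 1 + t ^ 3 * 0, - 0 + t ^ 3 * 0, t * y - 0,
        t * 0 - y - 0, - 0 - 0] := by ext1 j; fin_cases j <;> simp [F]
    have g2 : Fᵀ 2 = ![t * 0 + t ^ 3 * 0, t * 1 - 0 + t ^ 3 * 0, - 1 + t ^ 3 * 0, t * 0 - 0,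
        t * y - 0 - 0, - y - 0] := by ext1 j; fin_cases j <;> simp [F]
    have g3 : Fᵀ 3 = ![t * 0 + t ^ 3 * 1, t * 0 - 0 + t ^ 3 * 1, - 0 + t ^ 3 * 1,
        t * (- (h * (1 + t))) - 1, t * (- h) - (- (h * (1 + t))) - 1, - (- h) - 1]
        - t ^ 3 • ![1, 1, 1, 1, 1, 1] := by ext1 j; fin_cases j <;> simp [F]
    have g4 : Fᵀ 4 = ![t * 0 + t ^ 3 * 0, t * 0 - 0 + t ^ 3 * 0, - 0 + t ^ 3 * 0, t * 1 - 0,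
        t * 0 - 1 - 0, - 0 - 0] := by ext1 j; fin_cases j <;> simp [F]
    have g5 : Fᵀ 5 = ![t * 0 + t ^ 3 * 0, t * 0 - 0 + t ^ 3 * 0, - 0 + t ^ 3 * 0, t * 0 - 0,
        t * 1 - 0 - 0, - 1 - 0] := by ext1 j; fin_cases j <;> simp [F]
    rw [updateRow_mul]
    ext1 i j
    by_cases hi : i = 0
    · subst hi
      rw [updateRow_self, single_vecMul]
      fin_cases j <;> simp [F]
    · rw [updateRow_ne hi]
      fin_cases j
      · exact (hcol 0 i).trans (by rw [g0, hN0]; fin_cases i <;> simp at hi ⊢)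
      · exact (hcol 1 i).trans (by rw [g1, hx₁]; fin_cases i <;> simp at hi ⊢)
      · exact (hcol 2 i).trans (by
          rw [g2, hx₂]; fin_cases i <;> simp [mul_comm] at hi ⊢)
      · exact (hcol 3 i).trans (by
          rw [g3, mulVec_sub, mulVec_smul, hN0, hx₃]
          fin_cases i <;> simp [hh] at hi ⊢ <;> ring)
      · exact (hcol 4 i).trans (by rw [g4, hx₄]; fin_cases i <;> simp at hi ⊢)
      · exact (hcol 5 i).trans (by rw [g5, hx₅]; fin_cases i <;> simp at hi ⊢)
  have hdet := congrArg det hF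
  rw [det_mul, ← adjugate_apply, det_eq_of_zero_top_right, det_eq_of_zero_bottom_left,
    det_fin_three] at hdet
  have ht0 : 1 + t + t ^ 2 ≠ 0 := by
    have h0 : (1 + Polynomial.X + Polynomial.X ^ 2 : Polynomial ℤ) ≠ 0 := fun h0 => by
      simpa using congrArg (Polynomial.eval 0) h0
    simpa [ht] using Polynomial.toLaurent_ne_zero.2 h0
  refine mul_left_cancel₀ ht0 ?_
  simp [h₁, h₂, h₃] at hdet
  rw [hh] at hdet
  have e3 : t ^ (6 * n + 4) = y ^ 2 * t ^ 4 := by rw [hy]; ring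
  have e4 : t ^ (6 * n + 8) = y ^ 2 * t ^ 8 := by rw [hy]; ring
  have e5 : t ^ (12 * n + 11) = y ^ 4 * t ^ 11 := by rw [hy]; ring
  have e6 : t ^ (12 * n + 15) = y ^ 4 * t ^ 15 := by rw [hy]; ring
  have e7 : t ^ (18 * n + 19) = y ^ 6 * t ^ 19 := by rw [hy]; ring
  rw [e3, e4, e5, e6, e7]
  clear_value F
  linear_combination -hdet


/-! ### The semigroup and its generating series -/

/-- Membership in the semigroup `⟨6, 6n+4, 6n+8, 12n+11, 12n+15⟩` through its Apéry set
`{0, 6n+4, 6n+8, 12n+11, 12n+15, 18n+19}` with respect to `6`. -/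
def InSemigroup (n s : ℕ) : Prop :=
  s % 6 = 0 ∨ (s % 6 = 4 ∧ 6 * n + 4 ≤ s) ∨ (s % 6 = 2 ∧ 6 * n + 8 ≤ s) ∨
    (s % 6 = 5 ∧ 12 * n + 11 ≤ s) ∨ (s % 6 = 3 ∧ 12 * n + 15 ≤ s) ∨ (s % 6 = 1 ∧ 18 * n + 19 ≤ s)

lemma mem_closure_iff_inSemigroup (n s : ℕ) :
    s ∈ AddSubmonoid.closure ({6, 6 * n + 4, 6 * n + 8, 12 * n + 11, 12 * n + 15} : Set ℕ) ↔
      InSemigroup n s := by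
  constructor
  · intro h
    induction h using AddSubmonoid.closure_induction with
    | mem x hx =>
      simp only [Set.mem_insert_iff, Set.mem_singleton_iff] at hx
      unfold InSemigroup
      omega
    | zero => exact Or.inl rfl
    | add x y _ _ hx hy =>
      unfold InSemigroup at *
      rcases hx with hx | hx | hx | hx | hx | hx <;>
        rcases hy with hy | hy | hy | hy | hy | hy <;> omega
  · intro h
    set A := AddSubmonoid.closure ({6, 6 * n + 4, 6 * n + 8, 12 * n + 11, 12 * n + 15} : Set ℕ)
    have h6 : 6 ∈ A := AddSubmonoid.subset_closure (by simp)
    have h4 : 6 * n + 4 ∈ A := AddSubmonoid.subset_closure (by simp)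
    have h8 : 6 * n + 8 ∈ A := AddSubmonoid.subset_closure (by simp)
    have h11 : 12 * n + 11 ∈ A := AddSubmonoid.subset_closure (by simp)
    have h15 : 12 * n + 15 ∈ A := AddSubmonoid.subset_closure (by simp)
    have key (p : ℕ) (hp : p ∈ A) (hps : p ≤ s) (hm : s % 6 = p % 6) : s ∈ A := by
      obtain ⟨k, rfl⟩ : ∃ k, s = p + k * 6 := ⟨(s - p) / 6, by omega⟩
      exact A.add_mem hp (by simpa using A.nsmul_mem h6 k)
    rcases h with h | h | h | h | h | h
    · exact key 0 A.zero_mem (by omega) (by omega)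
    · exact key _ h4 (by omega) (by omega)
    · exact key _ h8 (by omega) (by omega)
    · exact key _ h11 (by omega) (by omega)
    · exact key _ h15 (by omega) (by omega)
    · exact key _ (A.add_mem h8 h11) (by omega) (by omega)

/-- A generating set of `A` contains every nonzero element of `A` that is not a sum of two nonzero
elements of `A`. -/
lemma mem_of_closure_eq {A : AddSubmonoid ℕ} {G : Set ℕ} (hG : AddSubmonoid.closure G = A) {a : ℕ}
    (haA : a ∈ A) (ha0 : a ≠ 0) (ha : ∀ x ∈ A, ∀ y ∈ A, x + y = a → x = 0 ∨ y = 0) : a ∈ G := by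
  by_contra haG
  have : ∀ x ∈ AddSubmonoid.closure G, x ≠ a := by
    intro x hx
    induction hx using AddSubmonoid.closure_induction with
    | mem x hx => exact fun h => haG (h ▸ hx)
    | zero => exact ha0.symm
    | add x y hx hy ihx ihy =>
      intro h
      rcases ha x (hG ▸ hx) y (hG ▸ hy) h with rfl | rfl
      · exact ihy (by simpa using h)
      · exact ihx (by simpa using h)
  exact this a (hG ▸ haA) rfl

lemma hasRank_semigroup (n : ℕ) (hn : 1 ≤ n) :
    HasRank (AddSubmonoid.closure
      ({6, 6 * n + 4, 6 * n + 8, 12 * n + 11, 12 * n + 15} : Set ℕ)) 5 := by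
  have hcard : ({6, 6 * n + 4, 6 * n + 8, 12 * n + 11, 12 * n + 15} : Finset ℕ).card = 5 := by
    repeat rw [Finset.card_insert_of_notMem
      (by simp only [Finset.mem_insert, Finset.mem_singleton]; omega)]
    rfl
  constructor
  · exact ⟨{6, 6 * n + 4, 6 * n + 8, 12 * n + 11, 12 * n + 15}, by push_cast; rfl, hcard⟩
  · rintro k ⟨G, hG, rfl⟩
    rw [← hcard]
    refine Finset.card_le_card fun a ha => ?_
    refine Finset.mem_coe.1
      (mem_of_closure_eq hG (AddSubmonoid.subset_closure (by simpa using ha)) ?_ ?_)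
    · simp only [Finset.mem_insert, Finset.mem_singleton] at ha
      omega
    · intro x hx y hy hxy
      rw [mem_closure_iff_inSemigroup] at hx hy
      simp only [Finset.mem_insert, Finset.mem_singleton] at ha
      unfold InSemigroup at hx hy
      rcases ha with rfl | rfl | rfl | rfl | rfl <;>
        rcases hx with hx | hx | hx | hx | hx | hx <;> omega

open Classical in
/-- The generating series of the semigroup, from its Apéry set with respect to `6`. -/
lemma one_sub_X_pow_mul_mk (n : ℕ) :
    (1 - PowerSeries.X ^ 6) * PowerSeries.mk (fun s => if InSemigroup n s then (1 : ℤ) else 0) =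
      1 + PowerSeries.X ^ (6 * n + 4) + PowerSeries.X ^ (6 * n + 8) + PowerSeries.X ^ (12 * n + 11)
        + PowerSeries.X ^ (12 * n + 15) + PowerSeries.X ^ (18 * n + 19) := by
  ext s
  simp only [sub_mul, one_mul, map_sub, map_add, PowerSeries.coeff_X_pow_mul',
    PowerSeries.coeff_X_pow, PowerSeries.coeff_one, PowerSeries.coeff_mk]
  have h : InSemigroup n s ↔ (s = 0 ∨ s = 6 * n + 4 ∨ s = 6 * n + 8 ∨ s = 12 * n + 11 ∨
      s = 12 * n + 15 ∨ s = 18 * n + 19) ∨ (6 ≤ s ∧ InSemigroup n (s - 6)) := by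
    unfold InSemigroup
    constructor
    · rintro (h | h | h | h | h | h) <;> omega
    · rintro ((h | h | h | h | h | h) | ⟨h6, h | h | h | h | h | h⟩) <;> omega
  have h' : 6 ≤ s ∧ InSemigroup n (s - 6) → ¬ (s = 0 ∨ s = 6 * n + 4 ∨ s = 6 * n + 8 ∨
      s = 12 * n + 11 ∨ s = 12 * n + 15 ∨ s = 18 * n + 19) := by
    unfold InSemigroup
    rintro ⟨h6, h | h | h | h | h | h⟩ <;> omega
  by_cases hq : 6 ≤ s ∧ InSemigroup n (s - 6)
  · have hne := h' hq
    push Not at hne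
    rw [if_pos (h.2 (Or.inr hq)), if_pos hq.1, if_pos hq.2]
    simp [hne]
  · have hz : (if 6 ≤ s then if InSemigroup n (s - 6) then (1 : ℤ) else 0 else 0) = 0 := by
      rw [← ite_and, if_neg hq]
    rw [hz]
    simp only [h, hq, or_false]
    split_ifs <;> first | rfl | omega

/-- If `S` contains `0` and has only finitely many gaps `g`, then `(1 - t) ∑_{s ∈ S} t ^ s` is the
polynomial `1 - (1 - t) ∑ t ^ g` with constant term `1`. -/
lemma exists_polynomial_of_cofinite {S : Set ℕ} [DecidablePred (· ∈ S)] {N : ℕ}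
    (h0 : 0 ∈ S) (hS : ∀ s, N ≤ s → s ∈ S) :
    ∃ Δ : Polynomial ℤ, Δ.coeff 0 = 1 ∧
      (Δ : PowerSeries ℤ) = (1 - PowerSeries.X) * PowerSeries.mk fun s => if s ∈ S then 1 else 0 := by
  refine ⟨1 - (1 - Polynomial.X) * ∑ g ∈ Finset.range N with g ∉ S, Polynomial.X ^ g, ?_, ?_⟩
  · have hz : (∑ g ∈ Finset.range N with g ∉ S, Polynomial.X ^ g : Polynomial ℤ).coeff 0 = 0 := by
      rw [Polynomial.finsetSum_coeff]
      refine Finset.sum_eq_zero fun g hg => ?_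
      have hg0 : 0 ≠ g := fun h => (Finset.mem_filter.1 hg).2 (h ▸ h0)
      rw [Polynomial.coeff_X_pow, if_neg hg0]
    rw [Polynomial.coeff_sub, Polynomial.mul_coeff_zero, hz]
    simp
  · have h1 : (1 - PowerSeries.X) * PowerSeries.mk (fun _ => (1 : ℤ)) = 1 := by
      rw [mul_comm]; exact PowerSeries.mk_one_mul_one_sub_eq_one ℤ
    have h2 : ((∑ g ∈ Finset.range N with g ∉ S, Polynomial.X ^ g : Polynomial ℤ) : PowerSeries ℤ)
        = PowerSeries.mk (fun _ => (1 : ℤ)) - PowerSeries.mk fun s => if s ∈ S then 1 else 0 := by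
      ext s
      have h3 : s ∉ S → s < N := fun hs => not_le.1 fun h => hs (hS s h)
      rw [Polynomial.coeff_coe, Polynomial.finsetSum_coeff]
      simp only [Polynomial.coeff_X_pow, Finset.sum_ite_eq, Finset.mem_filter, Finset.mem_range,
        map_sub, PowerSeries.coeff_mk]
      by_cases hs : s ∈ S <;> simp [hs, h3]
    push_cast
    rw [h2]
    linear_combination -h1

/-! ### The formal semigroup -/

/-- Integer polynomials with constant term `1` that agree up to a unit `± t ^ k` are equal. -/
lemma eq_of_associated_toLaurent {p q : Polynomial ℤ} (hp : p.coeff 0 = 1) (hq : q.coeff 0 = 1)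
    (h : Associated p.toLaurent q.toLaurent) : p = q := by
  have key : ∀ {p q : Polynomial ℤ}, p.coeff 0 = 1 → p.toLaurent ∣ q.toLaurent → p ∣ q := by
    rintro p q hp ⟨f, hf⟩
    obtain ⟨k, g, hg⟩ := LaurentPolynomial.exists_T_pow f
    have h1 : p ∣ Polynomial.X ^ k * q := by
      refine ⟨g, Polynomial.toLaurent_injective ?_⟩
      rw [map_mul, map_mul, hg, hf, Polynomial.toLaurent_X_pow]
      ring
    have h2 : IsCoprime p (Polynomial.X ^ k) := by
      refine IsCoprime.pow_right ⟨1, - p.divX, ?_⟩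
      have := Polynomial.divX_mul_X_add p
      rw [hp, map_one] at this
      linear_combination - this
    exact h2.dvd_of_dvd_mul_left h1
  obtain ⟨u, hu⟩ := associated_of_dvd_dvd (key hp h.dvd) (key hq h.symm.dvd)
  obtain ⟨c, -, hc⟩ := Polynomial.isUnit_iff.1 u.isUnit
  rw [← hc] at hu
  have h0 := congrArg (fun r => Polynomial.coeff r 0) hu
  simp only [Polynomial.coeff_mul_C, hp, hq, one_mul] at h0
  rw [← hu, h0, map_one, mul_one]

end ClosedBraid

open ClosedBraid in
theorem theorem5 (n : ℕ) (hn : 1 ≤ n) :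
    (∀ S : Set ℕ, ClosedBraid.IsFormalSemigroup (ClosedBraid.beta n) S ↔
      S = (AddSubmonoid.closure
        ({6, 6 * n + 4, 6 * n + 8, 12 * n + 11, 12 * n + 15} : Set ℕ) : Set ℕ)) ∧
    ClosedBraid.HasRank (AddSubmonoid.closure
      ({6, 6 * n + 4, 6 * n + 8, 12 * n + 11, 12 * n + 15} : Set ℕ)) 5 := by
  classical
  refine ⟨?_, hasRank_semigroup n hn⟩
  set S₀ : Set ℕ := (AddSubmonoid.closure
        ({6, 6 * n + 4, 6 * n + 8, 12 * n + 11, 12 * n + 15} : Set ℕ) : Set ℕ)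
  have hS₀ (s : ℕ) : s ∈ S₀ ↔ InSemigroup n s := mem_closure_iff_inSemigroup n s
  obtain ⟨Δ, hΔ0, hΔ⟩ := exists_polynomial_of_cofinite (S := S₀) (N := 18 * n + 19)
    ((hS₀ 0).2 (Or.inl rfl)) (fun s hs => (hS₀ s).2 (by unfold InSemigroup; omega))
  have hmul : (1 + Polynomial.X ^ 3) * (1 + Polynomial.X + Polynomial.X ^ 2) * Δ =
      1 + Polynomial.X ^ (6 * n + 4) + Polynomial.X ^ (6 * n + 8) + Polynomial.X ^ (12 * n + 11)
        + Polynomial.X ^ (12 * n + 15) + Polynomial.X ^ (18 * n + 19) := by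
    apply Polynomial.coe_injective ℤ
    have h := one_sub_X_pow_mul_mk n
    simp only [← hS₀] at h
    push_cast
    rw [← h, hΔ]
    ring
  have hadj : (1 - burau (beta n)).adjugate 0 0 = Δ.toLaurent := by
    have h1 := mul_adjugate_one_sub_burau_beta n rfl
    have h2 := congrArg Polynomial.toLaurent hmul
    simp only [map_mul, map_add, map_pow, map_one, Polynomial.toLaurent_X] at h2
    rw [← h2] at h1
    refine mul_left_cancel₀ (fun h0 => ?_) h1
    have h3 : Polynomial.toLaurent ((1 + Polynomial.X ^ 3) * (1 + Polynomial.X + Polynomial.X ^ 2) :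
        Polynomial ℤ) = Polynomial.toLaurent 0 := by
      simpa only [map_mul, map_add, map_pow, map_one, map_zero, Polynomial.toLaurent_X] using h0
    simpa using congrArg (Polynomial.eval 0) (Polynomial.toLaurent_injective h3)
  intro S
  constructor
  · rintro ⟨Δ', hA, h0, h'⟩
    rw [isAlexanderPolynomial_iff, hadj] at hA
    obtain rfl := eq_of_associated_toLaurent h0 hΔ0 hA
    rw [hΔ] at h'
    have hne : (1 - PowerSeries.X : PowerSeries ℤ) ≠ 0 := fun h => by
      simpa using congrArg (PowerSeries.coeff 0) h
    have h2 := mul_left_cancel₀ hne h'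
    ext s
    have h3 := congrArg (PowerSeries.coeff s) h2
    simp only [PowerSeries.coeff_mk] at h3
    by_cases hs : s ∈ S <;> by_cases hs' : s ∈ S₀ <;> simp_all
  · rintro rfl
    refine ⟨Δ, (isAlexanderPolynomial_iff _ _).2 (hadj ▸ Associated.refl _), hΔ0, ?_⟩
    convert hΔ
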